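/- Let $M$ be a matroid of rank $r$ on a finite ground set $E(M)$, with rank function $r(\cdot)$ and closure operator $\mathrm{cl}$, and let $[r]=\{1,\dots,r\}$. Let $\mathcal{Z}(M)$ be the set of cyclic flats of $M$, that is, flats that are (possibly empty) unions of circuits, ordered by inclusion. Call $M$ a fundamental transversal matroid if, for some integer $k\ge 0$, there are subsets $A_1,\dots,A_k$ (not necessarily distinct) of $E(M)$ such that (a) a set $I\subseteq E(M)$ is independent in $M$ if and only if there is an injection $f:I\to[k]$ with $x\in A_{f(x)}$ for all $x\in I$, and (b) for each $i\in[k]$, some element of $A_i$ lies in no $A_j$ with $j\neq i$. Then $M$ is a fundamental transversal matroid if and only if there is an injection $\phi:\mathcal{Z}(M)\to 2^{[r]}$ such that 1. $|\phi(F)|=r(F)$ for all $F\in\mathcal{Z}(M)$; 2. $\phi(\mathrm{cl}(F\cup G))=\phi(F)\cup\phi(G)$ for all $F,G\in\mathcal{Z}(M)$; and 3. $r\bigl(\bigcap_{F\in\mathcal{F}}F\bigr)=\bigl|\bigcap_{F\in\mathcal{F}}\phi(F)\bigr|$ for every subset $\mathcal{F}$ of $\mathcal{Z}(M)$, where for $\mathcal{F}=\emptyset$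 the two intersections are $E(M)$ and $[r]$. Moreover, for every injection $\phi$ satisfying 1 and 2, condition 3 is equivalent to the same condition required only for the filters (up-closed subsets) $\mathcal{F}$ of $\mathcal{Z}(M)$, and also to the same condition required only for the antichains $\mathcal{F}$ of $\mathcal{Z}(M)$. -/

import Mathlib

namespace Matroid

/-- A set is cyclic if it is a (possibly empty) union of circuits. -/
def IsCyclicSet {α : Type*} (M : Matroid α) (X : Set α) : Prop :=
  ∃ 𝒞 : Set (Set α), (∀ C ∈ 𝒞, M.IsCircuit C) ∧ X = ⋃₀ 𝒞

/-- The set `𝒵(M)` of cyclic flats, ordered by inclusion (as a subtype of `Set α`). -/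
def cyclicFlats {α : Type*} (M : Matroid α) : Set (Set α) :=
  {F | M.IsFlat F ∧ M.IsCyclicSet F}

/-- The closure of the union of two cyclic flats is a cyclic flat. -/
theorem closure_union_mem_cyclicFlats {α : Type*} (M : Matroid α) {F G : Set α}
    (hF : F ∈ M.cyclicFlats) (hG : G ∈ M.cyclicFlats) :
    M.closure (F ∪ G) ∈ M.cyclicFlats := by
  obtain ⟨hF, 𝒞, h𝒞, rfl⟩ := hF
  obtain ⟨hG, 𝒟, h𝒟, rfl⟩ := hG
  have hE : ⋃₀ 𝒞 ∪ ⋃₀ 𝒟 ⊆ M.E := Set.union_subset hF.subset_ground hG.subset_ground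
  refine ⟨M.isFlat_closure _, {C | M.IsCircuit C ∧ C ⊆ M.closure (⋃₀ 𝒞 ∪ ⋃₀ 𝒟)},
    fun C hC => hC.1, Set.Subset.antisymm (fun x hx => ?_)
      (Set.sUnion_subset fun C hC => hC.2)⟩
  have hsub := M.subset_closure (⋃₀ 𝒞 ∪ ⋃₀ 𝒟) hE
  by_cases hxX : x ∈ ⋃₀ 𝒞 ∪ ⋃₀ 𝒟
  · rcases hxX with ⟨C, hC, hxC⟩ | ⟨C, hC, hxC⟩
    · exact ⟨C, ⟨h𝒞 C hC, ((Set.subset_sUnion_of_mem hC).trans Set.subset_union_left).trans hsub⟩,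
        hxC⟩
    · exact ⟨C, ⟨h𝒟 C hC, ((Set.subset_sUnion_of_mem hC).trans Set.subset_union_right).trans hsub⟩,
        hxC⟩
  · obtain ⟨C, hCs, hC, hxC⟩ := exists_isCircuit_of_mem_closure hx hxX
    exact ⟨C, ⟨hC, hCs.trans (Set.insert_subset hx hsub)⟩, hxC⟩

/-- For cyclic flats `F` and `G`, the cyclic flat `cl(F ∪ G)`. -/
def cyclicFlatJoin {α : Type*} (M : Matroid α) (F G : M.cyclicFlats) : M.cyclicFlats :=
  ⟨M.closure ((F : Set α) ∪ (G : Set α)), M.closure_union_mem_cyclicFlats F.2 G.2⟩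

/-- `I` is a partial transversal of the set system `(A₁, …, Aₖ)`: there is an injection `f` from
`I` to the index set with `x ∈ A (f x)` for all `x ∈ I`. -/
def IsPartialTransversal {α : Type*} {k : ℕ} (A : Fin k → Set α) (I : Set α) : Prop :=
  ∃ f : I → Fin k, Function.Injective f ∧ ∀ x : I, (x : α) ∈ A (f x)

/-- `A` is a presentation of `M`: a set system on the ground set whose partial transversals are
exactly the independent sets of `M`. -/
def IsPresentation {α : Type*} (M : Matroid α) {k : ℕ} (A : Fin k → Set α) : Prop :=
  (∀ i, A i ⊆ M.E) ∧ ∀ I : Set α, M.Indep I ↔ IsPartialTransversal A I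

/-- `M` is a fundamental transversal matroid: it has a presentation in which each set has an
element that is in no other set of the presentation. -/
def IsFundamentalTransversal {α : Type*} (M : Matroid α) : Prop :=
  ∃ (k : ℕ) (A : Fin k → Set α), M.IsPresentation A ∧
    ∀ i : Fin k, (A i \ ⋃ j ∈ {j : Fin k | j ≠ i}, A j).Nonempty

/-- The equality `r(⋂ 𝓕) = |⋂ {φ(F) : F ∈ 𝓕}|` for a family `𝓕` of cyclic flats. For the empty
family, the intersections are the ground set and the whole of `Fin r`. -/
def RankInterEq {α : Type*} (M : Matroid α) {r : ℕ} (φ : M.cyclicFlats → Set (Fin r))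
    (𝓕 : Set M.cyclicFlats) : Prop :=
  M.eRk (M.E ∩ ⋂ F ∈ 𝓕, (F : Set α)) = (⋂ F ∈ 𝓕, φ F).encard

end Matroid

open Set

/-! Both sides are equivalent to the existence of a basis `b` of `M` that contains a basis of every
cyclic flat. The private elements of a presentation form such a basis. Conversely, the sets `E \
cl(B \ {b i})`, with `B = range b`, form a presentation in which `b i` is private to the `i`th set.
Given `b`, take `φ(F) = b ⁻¹' F`; bases inside one independent set respect unions and intersections.
Given `φ`, the element `b i` must lie in every `F` with `i ∈ φ(F)`, so `b` is an independent
transversal of the intersections `T i` of these flats. Rado's theorem supplies it, and condition 3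
with inclusion-exclusion verifies Rado's inequality. -/

theorem Finset.encard_biInter_coe {ι α : Type*} [DecidableEq α] {S : ι → Finset α} {t : Finset ι}
    (ht : t.Nonempty) : (⋂ i ∈ t, (S i : Set α)).encard = (t.inf' ht S).card := by
  rw [← Set.encard_coe_eq_coe_finsetCard]
  congr 1
  ext x
  simp [Finset.mem_inf']

theorem Finset.encard_biUnion_coe {ι α : Type*} [DecidableEq α] (S : ι → Finset α)
    (t : Finset ι) : (⋃ i ∈ t, (S i : Set α)).encard = (t.biUnion S).card := by
  rw [← Set.encard_coe_eq_coe_finsetCard]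
  congr 1
  ext x
  simp

theorem Set.biInter_sdiff_of_nonempty {ι α : Type*} {t : Set ι} (ht : t.Nonempty) (S : ι → Set α)
    (X : Set α) : ⋂ i ∈ t, S i \ X = (⋂ i ∈ t, S i) \ X := by
  obtain ⟨j, hj⟩ := ht
  ext x
  simp only [mem_iInter, mem_sdiff]
  exact ⟨fun hx ↦ ⟨fun i hi ↦ (hx i hi).1, (hx j hj).2⟩, fun hx i hi ↦ ⟨hx.1 i hi, hx.2⟩⟩

theorem Monotone.biInter_upperClosure {ι α : Type*} [Preorder ι] {f : ι → Set α} (hf : Monotone f)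
    (s : Set ι) : ⋂ i ∈ upperClosure s, f i = ⋂ i ∈ s, f i := by
  refine subset_antisymm (biInter_mono subset_upperClosure fun _ _ ↦ subset_rfl)
    (subset_iInter₂ fun i hi ↦ ?_)
  obtain ⟨j, hj, hji⟩ := mem_upperClosure.1 hi
  exact (biInter_subset_of_mem hj).trans (hf hji)

/-- Inclusion-exclusion expresses the size of a union through the sizes of nonempty intersections.
-/
theorem Finset.encard_biUnion_eq_of_forall_encard_biInter_eq {ι α β : Type*} (s : Finset ι)
    {S : ι → Set α} {T : ι → Set β} (hS : ∀ i, (S i).Finite) (hT : ∀ i, (T i).Finite)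
    (h : ∀ t ⊆ s, t.Nonempty → (⋂ i ∈ t, S i).encard = (⋂ i ∈ t, T i).encard) :
    (⋃ i ∈ s, S i).encard = (⋃ i ∈ s, T i).encard := by
  classical
  lift S to ι → Finset α using hS
  lift T to ι → Finset β using hT
  beta_reduce at h ⊢
  rw [Finset.encard_biUnion_coe, Finset.encard_biUnion_coe, Nat.cast_inj, ← Nat.cast_inj (R := ℤ),
    Finset.inclusion_exclusion_card_biUnion, Finset.inclusion_exclusion_card_biUnion]
  refine Finset.sum_congr rfl fun t _ ↦ ?_
  obtain ⟨hts, ht⟩ := Finset.mem_filter.1 t.2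
  have := h t.1 (Finset.mem_powerset.1 hts) ht
  rw [Finset.encard_biInter_coe ht, Finset.encard_biInter_coe ht, Nat.cast_inj] at this
  rw [this]

namespace Matroid

/-! ### Rado's and Hall's theorems -/

/-- **Rado's theorem** on independent transversals, for finite families of finite sets. -/
theorem exists_indep_range_of_card_le_eRk {ι α : Type*} [Fintype ι] (M : Matroid α)
    (T : ι → Finset α) (hT : ∀ s : Finset ι, (s.card : ℕ∞) ≤ M.eRk (⋃ i ∈ s, (T i : Set α))) :
    ∃ b : ι → α, (∀ i, b i ∈ T i) ∧ Function.Injective b ∧ M.Indep (range b) := by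
  classical
  induction h : ∑ i, (T i).card using Nat.strong_induction_on generalizing T with
  | _ n ih =>
  subst h
  by_cases hbig : ∃ i, 1 < (T i).card
  · obtain ⟨i, hi⟩ := hbig
    obtain ⟨x, hx, y, hy, hxy⟩ := Finset.one_lt_card.1 hi
    by_cases hgood : ∃ z ∈ T i, ∀ s : Finset ι, (s.card : ℕ∞) ≤
        M.eRk (⋃ j ∈ s, (Function.update T i ((T i).erase z) j : Set α))
    · obtain ⟨z, hz, hs⟩ := hgood
      have hle : ∀ j, Function.update T i ((T i).erase z) j ⊆ T j := by
        intro j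
        obtain rfl | hj := eq_or_ne j i
        · simpa using Finset.erase_subset z (T j)
        · simp [hj]
      obtain ⟨b, hb, hb'⟩ := ih _ (Finset.sum_lt_sum (fun j _ ↦ Finset.card_le_card (hle j))
        ⟨i, Finset.mem_univ i, by simpa using Finset.card_erase_lt_of_mem hz⟩) _ hs rfl
      exact ⟨b, fun j ↦ hle j (hb j), hb'⟩
    -- If neither `x` nor `y` can be deleted from `T i`, deficient index sets `s` and `t`, both
    -- containing `i`, witness this. As `x ≠ y`, `X ∪ Y` covers the union over `s ∪ t`, and `X ∩ Y`
    -- covers that over `(s ∩ t) \ {i}`. Submodularity gives `|s| + |t| - 1 ≤ r(X) + r(Y) ≤ |s| +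
    -- |t| - 2`.
    exfalso
    push Not at hgood
    have hdef (z) (hz : z ∈ T i) : ∃ s : Finset ι, i ∈ s ∧
        M.eRk (⋃ j ∈ s, (Function.update T i ((T i).erase z) j : Set α)) < s.card := by
      obtain ⟨s, hs⟩ := hgood z hz
      refine ⟨s, by_contra fun his ↦ (hT s).not_gt ?_, hs⟩
      convert hs using 5 with j hj
      rw [Function.update_of_ne (by rintro rfl; exact his hj)]
    obtain ⟨s, his, hs⟩ := hdef x hx
    obtain ⟨t, hit, ht⟩ := hdef y hy
    set X := ⋃ j ∈ s, (Function.update T i ((T i).erase x) j : Set α) with hX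
    set Y := ⋃ j ∈ t, (Function.update T i ((T i).erase y) j : Set α) with hY
    have hU : ⋃ j ∈ s ∪ t, (T j : Set α) ⊆ X ∪ Y := by
      intro a ha
      simp only [mem_iUnion] at ha
      obtain ⟨j, hj, ha⟩ := ha
      obtain rfl | hji := eq_or_ne j i
      · obtain rfl | hax := eq_or_ne a x
        · exact .inr (mem_biUnion (x := j) hit (by simpa [hxy] using ha))
        · exact .inl (mem_biUnion (x := j) his (by simpa [hax] using ha))
      · rcases Finset.mem_union.1 hj with hj | hj
        · exact .inl (mem_biUnion (x := j) hj (by simpa [hji] using ha))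
        · exact .inr (mem_biUnion (x := j) hj (by simpa [hji] using ha))
    have hI : ⋃ j ∈ (s ∩ t).erase i, (T j : Set α) ⊆ X ∩ Y := by
      refine iUnion₂_subset fun j hj ↦ ?_
      obtain ⟨hji, hj⟩ := Finset.mem_erase.1 hj
      obtain ⟨hjs, hjt⟩ := Finset.mem_inter.1 hj
      intro a ha
      exact ⟨mem_biUnion (x := j) hjs (by simpa [hji] using ha),
        mem_biUnion (x := j) hjt (by simpa [hji] using ha)⟩
    have h1 := (hT _).trans (M.eRk_mono hU)
    have h2 := (hT _).trans (M.eRk_mono hI)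
    have h3 := (add_le_add h2 h1).trans (M.eRk_submod X Y)
    have hcard := Finset.card_union_add_card_inter s t
    have hpos := Finset.card_erase_add_one (Finset.mem_inter.2 ⟨his, hit⟩)
    obtain ⟨p, hp⟩ := ENat.ne_top_iff_exists.1 hs.ne_top
    obtain ⟨q, hq⟩ := ENat.ne_top_iff_exists.1 ht.ne_top
    rw [← hp, Nat.cast_lt] at hs
    rw [← hq, Nat.cast_lt] at ht
    rw [← hp, ← hq, ← Nat.cast_add, ← Nat.cast_add, Nat.cast_le] at h3
    omega
  push Not at hbig
  have hne (i) : (T i).Nonempty := by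
    rw [Finset.nonempty_iff_ne_empty]
    intro h0
    simpa [h0] using hT {i}
  choose b hb using fun i ↦ Finset.card_eq_one.1
    ((hbig i).antisymm (Finset.card_pos.2 (hne i)))
  have hrk : (Fintype.card ι : ℕ∞) ≤ M.eRk (range b) := by
    have := hT Finset.univ
    simpa [hb, iUnion_singleton_eq_range] using this
  have hcard : (range b).encard = (Finset.univ.image b).card := by
    rw [← Set.encard_coe_eq_coe_finsetCard]; simp
  have hle : (Finset.univ.image b).card ≤ Fintype.card ι := Finset.card_image_le
  have hge : (Fintype.card ι : ℕ∞) ≤ (Finset.univ.image b).card :=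
    hcard ▸ hrk.trans (M.eRk_le_encard _)
  refine ⟨b, by simp [hb], ?_, ?_⟩
  · have := Finset.card_image_iff.1 (hle.antisymm (Nat.cast_le.1 hge))
    simpa using this
  · rw [indep_iff_eRk_eq_encard_of_finite (finite_range b)]
    exact (M.eRk_le_encard _).antisymm ((hcard.trans_le (Nat.cast_le.2 hle)).trans hrk)

/-- **Hall's theorem** for partial transversals. -/
theorem isPartialTransversal_iff_forall_encard_le {α : Type*} {k : ℕ} {A : Fin k → Set α}
    {I : Set α} : IsPartialTransversal A I ↔
      ∀ S ⊆ I, S.encard ≤ {i | ∃ x ∈ S, x ∈ A i}.encard := by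
  classical
  refine ⟨fun ⟨f, hf, hA⟩ S hSI ↦ ?_, fun h ↦ ?_⟩
  · rw [← ENat.card_coe_set_eq, ← encard_univ,
      ← (hf.comp (inclusion_injective hSI)).encard_image]
    refine encard_le_encard ?_
    rintro _ ⟨x, -, rfl⟩
    exact ⟨x, x.2, hA (inclusion hSI x)⟩
  · refine (Fintype.all_card_le_filter_rel_iff_exists_injective
      (fun (x : I) i ↦ (x : α) ∈ A i)).1 fun S ↦ ?_
    have hS := h (Subtype.val '' (S : Set I)) (by simp)
    rw [Subtype.val_injective.encard_image, Set.encard_coe_eq_coe_finsetCard] at hS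
    rw [← Nat.cast_le (α := ℕ∞), ← Set.encard_coe_eq_coe_finsetCard {i | _}]
    refine hS.trans (encard_le_encard ?_)
    rintro i ⟨_, ⟨x, hx, rfl⟩, hxi⟩
    simpa using ⟨x.1, ⟨x.2, hx⟩, hxi⟩

theorem IsPartialTransversal.encard_le {α : Type*} {k : ℕ} {A : Fin k → Set α} {I : Set α}
    (h : IsPartialTransversal A I) {K : Set (Fin k)} (hK : ∀ x ∈ I, ∀ i, x ∈ A i → i ∈ K) :
    I.encard ≤ K.encard :=
  (isPartialTransversal_iff_forall_encard_le.1 h I subset_rfl).trans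
    (encard_le_encard fun i ⟨x, hx, hxi⟩ ↦ hK x hx i hxi)

/-! ### Cyclic flats -/

theorem IsCircuit.closure_mem_cyclicFlats {α : Type*} {M : Matroid α} {C : Set α}
    (hC : M.IsCircuit C) : M.closure C ∈ M.cyclicFlats := by
  refine ⟨M.isFlat_closure C, {D | M.IsCircuit D ∧ D ⊆ M.closure C}, fun D hD ↦ hD.1,
    subset_antisymm (fun x hx ↦ ?_) (sUnion_subset fun D hD ↦ hD.2)⟩
  by_cases hxC : x ∈ C
  · exact ⟨C, ⟨hC, M.subset_closure C hC.subset_ground⟩, hxC⟩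
  · obtain ⟨D, hDs, hD, hxD⟩ := exists_isCircuit_of_mem_closure hx hxC
    exact ⟨D, ⟨hD, hDs.trans (insert_subset hx (M.subset_closure C hC.subset_ground))⟩, hxD⟩

/-- The union of the circuits contained in a flat `H` is a cyclic flat, and the elements of `H`
outside it are coloops of the restriction to `H`. -/
theorem IsFlat.exists_mem_cyclicFlats {α : Type*} {M : Matroid α} {H : Set α} (hH : M.IsFlat H) :
    ∃ F ∈ M.cyclicFlats, F ⊆ H ∧
      ∀ X ⊆ H, M.eRk X = M.eRk (X ∩ F) + (X \ F).encard := by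
  set F := ⋃₀ {C | M.IsCircuit C ∧ C ⊆ H} with hF
  have hFH : F ⊆ H := sUnion_subset fun C hC ↦ hC.2
  have hFflat : M.closure F = F := by
    refine subset_antisymm (fun x hx ↦ ?_) (M.subset_closure F (hFH.trans hH.subset_ground))
    by_contra hxF
    obtain ⟨C, hCs, hC, hxC⟩ := exists_isCircuit_of_mem_closure hx hxF
    have hxH : x ∈ H := hH.closure ▸ M.closure_subset_closure hFH hx
    exact hxF ⟨C, ⟨hC, hCs.trans (insert_subset hxH hFH)⟩, hxC⟩
  refine ⟨F, ⟨hFflat ▸ M.isFlat_closure F, _, fun C hC ↦ hC.1, hF⟩, hFH, fun X hX ↦ ?_⟩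
  refine le_antisymm ?_ ?_
  · conv_lhs => rw [← inter_union_sdiff X F]
    exact M.eRk_union_le_eRk_add_encard _ _
  · have hXE := hX.trans hH.subset_ground
    obtain ⟨I, hI⟩ := M.exists_isBasis (X ∩ F) (inter_subset_left.trans hXE)
    have hIX : I ∪ X \ F ⊆ X :=
      union_subset (hI.subset.trans inter_subset_left) sdiff_subset
    -- A circuit in this set lies in `H`, hence in `F`, hence in the independent set `I`.
    have hind : M.Indep (I ∪ X \ F) := by
      rw [indep_iff_forall_subset_not_isCircuit (hIX.trans hXE)]
      intro C hCs hC
      have hCF : C ⊆ F := subset_sUnion_of_mem ⟨hC, hCs.trans (hIX.trans hX)⟩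
      refine hC.not_indep (hI.indep.subset fun x hx ↦ ?_)
      exact (hCs hx).resolve_right fun h ↦ h.2 (hCF hx)
    rw [hI.eRk_eq_encard, ← encard_union_eq]
    · exact hind.encard_le_eRk_of_subset hIX
    · exact disjoint_left.2 fun x hx hx' ↦ hx'.2 (hI.subset hx).2

/-! ### Bases that span every cyclic flat -/

/-- `b` enumerates an independent set that contains a basis of each cyclic flat. -/
def IsCyclicFlatFrame {α : Type*} (M : Matroid α) {r : ℕ} (b : Fin r → α) : Prop :=
  Function.Injective b ∧ M.Indep (range b) ∧ ∀ F ∈ M.cyclicFlats, F ⊆ M.closure (F ∩ range b)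

/-- It suffices to treat circuits. By Hall, a circuit `C` meets a set `K` of fewer than `|C|`
members of the presentation. Then `C ∪ b(K)` has rank at most `|K|`, which both `C` and `b(K)`
attain, so their closures agree. -/
theorem IsFundamentalTransversal.exists_isCyclicFlatFrame {α : Type*} {M : Matroid α} [M.Finite]
    {r : ℕ} (hr : M.eRank = r) (h : M.IsFundamentalTransversal) :
    ∃ b : Fin r → α, M.IsCyclicFlatFrame b := by
  obtain ⟨k, A, ⟨hAE, hA⟩, hpriv⟩ := h
  choose b hb using hpriv
  have hbA (i) : b i ∈ A i := (hb i).1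
  have hbA' {i j} (hij : b i ∈ A j) : j = i := by
    by_contra hne
    exact (hb i).2 (mem_biUnion (x := j) hne hij)
  have hinj : Function.Injective b := fun i j hij ↦ hbA' (by rw [← hij]; exact hbA i)
  have hind : M.Indep (range b) := by
    rw [hA]
    refine ⟨(Equiv.ofInjective b hinj).symm, Equiv.injective _, fun x ↦ ?_⟩
    obtain ⟨_, i, rfl⟩ := x
    rw [Equiv.ofInjective_symm_apply]
    exact hbA i
  obtain rfl : k = r := by
    have h1 := hind.encard_le_eRank
    rw [hr, ← image_univ, hinj.encard_image, encard_univ, ENat.card_eq_coe_fintype_card,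
      Fintype.card_fin, Nat.cast_le] at h1
    obtain ⟨B, hB⟩ := M.exists_isBase
    have h2 := ((hA B).1 hB.indep).encard_le (K := univ) (by simp)
    rw [hB.encard_eq_eRank, hr, encard_univ, ENat.card_eq_coe_fintype_card,
      Fintype.card_fin, Nat.cast_le] at h2
    exact h1.antisymm h2
  refine ⟨b, hinj, hind, ?_⟩
  rintro F ⟨hF, 𝒞, h𝒞, rfl⟩
  refine sUnion_subset fun C hC𝒞 ↦ ?_
  have hC := h𝒞 C hC𝒞
  have hCF : M.closure C ⊆ ⋃₀ 𝒞 := by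
    conv_rhs => rw [← hF.closure]
    exact M.closure_subset_closure (subset_sUnion_of_mem hC𝒞)
  refine subset_trans ?_ (M.closure_subset_closure (inter_subset_inter_left _ hCF))
  obtain ⟨S, hSC, hS⟩ : ∃ S ⊆ C, {i | ∃ x ∈ S, x ∈ A i}.encard < S.encard := by
    have := mt (hA C).2 hC.not_indep
    rw [isPartialTransversal_iff_forall_encard_le] at this
    push Not at this
    exact this
  have hSnot : ¬ M.Indep S := fun hi ↦ hS.not_ge
    (isPartialTransversal_iff_forall_encard_le.1 ((hA S).1 hi) S subset_rfl)
  obtain rfl := hC.eq_of_not_indep_subset hSnot hSC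
  set K := {i | ∃ x ∈ S, x ∈ A i} with hK
  have hXK : M.eRk (S ∪ b '' K) ≤ K.encard := by
    rw [eRk_le_iff]
    intro I hI hIi
    refine ((hA I).1 hIi).encard_le fun x hx i hxi ↦ ?_
    rcases hI hx with hxS | ⟨j, hj, rfl⟩
    · exact ⟨x, hxS, hxi⟩
    · exact hbA' hxi ▸ hj
  have hKS : K.encard ≤ M.eRk S := by
    obtain ⟨e, he⟩ := hC.nonempty
    have := encard_sdiff_singleton_add_one he
    rw [← (hC.sdiff_singleton_isBasis he).encard_eq_eRk]
    rw [← this] at hS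
    exact Order.le_of_lt_add_one hS
  have hKb : M.eRk (b '' K) = K.encard := by
    rw [(hind.subset (image_subset_range b K)).eRk_eq_encard, hinj.encard_image]
  have h1 : M.closure S = M.closure (S ∪ b '' K) :=
    (RankFinite.isRkFinite S).closure_eq_closure_of_subset_of_eRk_ge_eRk subset_union_left
      (hXK.trans hKS)
  have h2 : M.closure (b '' K) = M.closure (S ∪ b '' K) :=
    (RankFinite.isRkFinite _).closure_eq_closure_of_subset_of_eRk_ge_eRk subset_union_right
      (hXK.trans hKb.ge)
  refine (M.subset_closure S hC.subset_ground).trans ?_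
  rw [h1, ← h2]
  refine M.closure_subset_closure (subset_inter ?_ (image_subset_range b K))
  rw [h2]
  exact subset_union_right.trans (M.subset_closure _
    (union_subset hC.subset_ground ((image_subset_range b K).trans hind.subset_ground)))

theorem IsCyclicFlatFrame.isFundamentalTransversal {α : Type*} {M : Matroid α} [M.Finite] {r : ℕ}
    {b : Fin r → α} (h : M.IsCyclicFlatFrame b) (hr : M.eRank = r) :
    M.IsFundamentalTransversal := by
  obtain ⟨hinj, hind, hcl⟩ := h
  have hbase : M.closure (range b) = M.E := by
    rw [← M.closure_ground]
    refine (RankFinite.isRkFinite _).closure_eq_closure_of_subset_of_eRk_ge_eRk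
      hind.subset_ground ?_
    rw [eRk_ground, hr, hind.eRk_eq_encard, ← image_univ, hinj.encard_image]
    simp
  have himg (K : Set (Fin r)) : b '' K ⊆ M.E := (image_subset_range b K).trans hind.subset_ground
  have hmem {i j} : b i ∈ M.E \ M.closure (b '' {j}ᶜ) ↔ i = j := by
    rw [mem_sdiff, and_iff_right (hind.subset_ground (mem_range_self i))]
    refine ⟨fun hi ↦ by_contra fun hij ↦ hi (M.mem_closure_of_mem ⟨i, hij, rfl⟩ (himg _)), ?_⟩
    rintro rfl hi
    have := (hind.closure_inter_eq_self_of_subset (image_subset_range b {i}ᶜ)).subset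
      ⟨hi, mem_range_self i⟩
    rw [hinj.mem_set_image] at this
    exact this rfl
  refine ⟨r, fun i ↦ M.E \ M.closure (b '' {i}ᶜ), ⟨fun i ↦ sdiff_subset, fun I ↦ ⟨fun hI ↦ ?_,
    fun hI ↦ ?_⟩⟩, fun i ↦ ⟨b i, hmem.2 rfl, ?_⟩⟩
  · rw [isPartialTransversal_iff_forall_encard_le]
    intro S hS
    set K := {i | ∃ x ∈ S, x ∈ M.E \ M.closure (b '' {i}ᶜ)} with hK
    have hSE : S ⊆ M.E := hS.trans hI.subset_ground
    have hSK : S ⊆ M.closure (b '' K) := by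
      -- Closure commutes with nonempty intersections of subsets of a basis; the empty intersection
      -- is handled apart.
      obtain hne | hne := (Kᶜ).eq_empty_or_nonempty
      · rw [compl_empty_iff.1 hne, image_univ, hbase]
        exact hSE
      · have hKint : b '' K = ⋂ i ∈ Kᶜ, b '' {i}ᶜ := by
          rw [← hinj.injOn.image_biInter_eq hne]
          congr 1
          ext j
          simp only [mem_iInter, mem_compl_iff, mem_singleton_iff]
          exact ⟨fun hj i hi hji ↦ hi (hji ▸ hj), fun hj ↦ by_contra fun hjK ↦ hj j hjK rfl⟩
        rw [hKint, closure_biInter_eq_biInter_closure_of_biUnion_indep (I := fun i ↦ b '' {i}ᶜ) hne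
          (hind.subset (iUnion₂_subset fun _ _ ↦ image_subset_range _ _))]
        refine subset_iInter₂ fun i hi x hx ↦ by_contra fun hxi ↦ hi ⟨x, hx, hSE hx, hxi⟩
    rw [← (hI.subset hS).eRk_eq_encard, ← hinj.encard_image K]
    exact (M.eRk_mono hSK).trans ((M.eRk_closure_eq _).trans_le (M.eRk_le_encard _))
  · have hIE : I ⊆ M.E := fun x hx ↦ by
      obtain ⟨f, -, hf⟩ := hI
      exact (hf ⟨x, hx⟩).1
    rw [indep_iff_forall_subset_not_isCircuit hIE]
    intro C hCI hC
    have hspan := (M.subset_closure C hC.subset_ground).trans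
      (hcl _ hC.closure_mem_cyclicFlats)
    -- `C` is spanned by the basis elements in `cl C`, so it only meets sets indexed by these. Hall
    -- then gives `|C| ≤ r(C)`, which is impossible for a circuit.
    have hle := (isPartialTransversal_iff_forall_encard_le.1 hI C hCI).trans
      (encard_le_encard (t := b ⁻¹' M.closure C) ?_)
    · rw [← hinj.encard_image, image_preimage_eq_inter_range] at hle
      have hle' := hle.trans ((hind.inter_left _).encard_le_eRk_of_subset inter_subset_left)
      rw [eRk_closure_eq] at hle'
      have hfin : C.Finite := M.ground_finite.subset hC.subset_ground
      exact hC.not_indep ((indep_iff_eRk_eq_encard_of_finite hfin).2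
        ((M.eRk_le_encard C).antisymm hle'))
    · rintro i ⟨x, hx, hxE, hxi⟩
      by_contra hi
      refine hxi (M.closure_subset_closure ?_ (hspan hx))
      rintro _ ⟨hj, j, rfl⟩
      exact ⟨j, fun hji ↦ hi (by rw [mem_singleton_iff] at hji; exact hji ▸ hj), rfl⟩
  · simp only [mem_iUnion, not_exists]
    intro j hj hij
    exact hj (hmem.1 hij).symm

theorem IsCyclicFlatFrame.exists_map {α : Type*} {M : Matroid α} {r : ℕ}
    {b : Fin r → α} (h : M.IsCyclicFlatFrame b) (hr : M.eRank = r) :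
    ∃ φ : M.cyclicFlats → Set (Fin r), Function.Injective φ ∧
      (∀ F : M.cyclicFlats, (φ F).encard = M.eRk (F : Set α)) ∧
      (∀ F G : M.cyclicFlats, φ (M.cyclicFlatJoin F G) = φ F ∪ φ G) ∧
      ∀ 𝓕 : Set M.cyclicFlats, M.RankInterEq φ 𝓕 := by
  obtain ⟨hinj, hind, hcl⟩ := h
  have hbasis (F : M.cyclicFlats) : M.IsBasis ((F : Set α) ∩ range b) F :=
    hind.inter_isBasis_closure_iff_subset_closure_inter.2 (hcl F F.2)
  have henc (X : Set α) : (b ⁻¹' X).encard = (X ∩ range b).encard := by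
    rw [← hinj.encard_image, image_preimage_eq_inter_range]
  refine ⟨fun F ↦ b ⁻¹' F, fun F G hFG ↦ ?_, fun F ↦ ?_, fun F G ↦ ?_, fun 𝓕 ↦ ?_⟩
  · have hFG' : (F : Set α) ∩ range b = (G : Set α) ∩ range b := by
      rw [← image_preimage_eq_inter_range, ← image_preimage_eq_inter_range]
      exact congrArg (b '' ·) hFG
    ext1
    rw [← F.2.1.closure, ← G.2.1.closure, ← (hbasis F).closure_eq_closure,
      ← (hbasis G).closure_eq_closure, hFG']
  · rw [henc, (hbasis F).encard_eq_eRk]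
  · have hFG : M.closure ((F : Set α) ∪ G) = M.closure ((F ∪ G : Set α) ∩ range b) := by
      rw [union_inter_distrib_right, ← M.closure_union_closure_left_eq (_ ∩ _),
        ← M.closure_union_closure_right_eq _ (_ ∩ _), (hbasis F).closure_eq_closure,
        (hbasis G).closure_eq_closure, closure_union_closure_left_eq,
        closure_union_closure_right_eq]
    have := hind.closure_inter_eq_self_of_subset (J := (F ∪ G : Set α) ∩ range b)
      inter_subset_right
    rw [← hFG] at this
    rw [← preimage_union, cyclicFlatJoin]
    apply hinj.image_injective
    rw [image_preimage_eq_inter_range, image_preimage_eq_inter_range, this]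
  · obtain rfl | hne := 𝓕.eq_empty_or_nonempty
    · simp [RankInterEq, hr]
    · rw [RankInterEq, eRk_ground_inter, ← preimage_iInter₂, henc,
        (hind.inter_isBasis_biInter hne fun F _ ↦ hbasis F).encard_eq_eRk]

/-- For Rado's inequality, let `H` be the closure of the union of the `T i` over `s`, and `F` its
largest cyclic flat, so that `r(H) = r(F) + |H \ F|`. The sets `T i \ F` have a union as large as
that of the `D i \ φ(F)`, which together with `φ(F)` covers `s`. -/
theorem exists_isCyclicFlatFrame_of_map {α : Type*} {M : Matroid α} [M.Finite] {r : ℕ}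
    {φ : M.cyclicFlats → Set (Fin r)}
    (hrk : ∀ F : M.cyclicFlats, (φ F).encard = M.eRk (F : Set α))
    (hinter : ∀ 𝓕 : Set M.cyclicFlats, M.RankInterEq φ 𝓕) :
    ∃ b : Fin r → α, M.IsCyclicFlatFrame b := by
  -- Intersecting with `M.E` matters when `i` lies in no `φ F`.
  set T : Fin r → Set α := fun i ↦ M.E ∩ ⋂ F ∈ {F | i ∈ φ F}, (F : Set α) with hT
  set D : Fin r → Set (Fin r) := fun i ↦ ⋂ F ∈ {F | i ∈ φ F}, φ F with hD
  have hTE (i) : T i ⊆ M.E := inter_subset_left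
  have hTfin (i) : (T i).Finite := M.ground_finite.subset (hTE i)
  have hrado (s : Finset (Fin r)) : (s.card : ℕ∞) ≤ M.eRk (⋃ i ∈ s, T i) := by
    obtain ⟨F, hF, hFH, hsplit⟩ := (M.isFlat_closure (⋃ i ∈ s, T i)).exists_mem_cyclicFlats
    have hTH : ⋃ i ∈ s, T i ⊆ M.closure (⋃ i ∈ s, T i) :=
      M.subset_closure _ (iUnion₂_subset fun i _ ↦ hTE i)
    have hcard : (⋃ i ∈ s, T i \ F).encard = (⋃ i ∈ s, D i \ φ ⟨F, hF⟩).encard := by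
      refine s.encard_biUnion_eq_of_forall_encard_biInter_eq (fun i ↦ (hTfin i).sdiff)
        (fun i ↦ toFinite _) fun t hts ht ↦ ?_
      -- Condition 3 for this family and for the family with `F` added; the difference of the two
      -- equalities compares the parts outside `F` and `φ(F)`.
      have h1 := hinter {G | ∃ i ∈ t, i ∈ φ G}
      have h2 := hinter (insert ⟨F, hF⟩ {G | ∃ i ∈ t, i ∈ φ G})
      rw [RankInterEq] at h1 h2
      have hTt : M.E ∩ ⋂ G ∈ {G | ∃ i ∈ t, i ∈ φ G}, (G : Set α) = ⋂ i ∈ t, T i := by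
        ext x
        obtain ⟨j, hj⟩ := ht
        simp only [hT, mem_inter_iff, mem_iInter, mem_ofPred_eq]
        exact ⟨fun hx i hi ↦ ⟨hx.1, fun G hG ↦ hx.2 G ⟨i, hi, hG⟩⟩,
          fun hx ↦ ⟨(hx j hj).1, fun G ⟨i, hi, hG⟩ ↦ (hx i hi).2 G hG⟩⟩
      have hDt : ⋂ G ∈ {G | ∃ i ∈ t, i ∈ φ G}, φ G = ⋂ i ∈ t, D i := by
        ext x
        simp only [hD, mem_iInter, mem_ofPred_eq]
        exact ⟨fun hx i hi G hG ↦ hx G ⟨i, hi, hG⟩, fun hx G ⟨i, hi, hG⟩ ↦ hx i hi G hG⟩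
      rw [biInter_insert, biInter_insert, inter_left_comm, hTt, hDt, inter_comm,
        inter_comm (φ _)] at h2
      rw [hTt, hDt] at h1
      obtain ⟨j, hj⟩ := ht
      have hsp := hsplit (⋂ i ∈ t, T i)
        ((biInter_subset_of_mem hj).trans ((subset_biUnion_of_mem (hts hj)).trans hTH))
      rw [h1, h2, ← encard_sdiff_add_encard_inter (⋂ i ∈ t, D i) (φ ⟨F, hF⟩), add_comm] at hsp
      replace hsp := ENat.add_right_injective_of_ne_top (toFinite _).encard_lt_top.ne hsp
      have ht' : {i | i ∈ t}.Nonempty := ⟨j, hj⟩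
      exact (congrArg encard (biInter_sdiff_of_nonempty ht' T F)).trans
        (hsp.symm.trans (congrArg encard (biInter_sdiff_of_nonempty ht' D (φ ⟨F, hF⟩))).symm)
    have hs : (s : Set (Fin r)) ⊆ φ ⟨F, hF⟩ ∪ ⋃ i ∈ s, D i \ φ ⟨F, hF⟩ := by
      intro i hi
      by_cases hiF : i ∈ φ ⟨F, hF⟩
      · exact .inl hiF
      · exact .inr (mem_biUnion (x := i) hi ⟨by simp [hD], hiF⟩)
    calc (s.card : ℕ∞) = (s : Set (Fin r)).encard := (encard_coe_eq_coe_finsetCard s).symm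
      _ ≤ (φ ⟨F, hF⟩).encard + (⋃ i ∈ s, D i \ φ ⟨F, hF⟩).encard :=
        (encard_le_encard hs).trans (encard_union_le _ _)
      _ = M.eRk F + (⋃ i ∈ s, T i \ F).encard := by rw [hrk, hcard]
      _ ≤ M.eRk F + (M.closure (⋃ i ∈ s, T i) \ F).encard := by
        gcongr
        exact iUnion₂_subset fun i hi ↦
          sdiff_subset_sdiff_left ((subset_biUnion_of_mem hi).trans hTH)
      _ = M.eRk (M.closure (⋃ i ∈ s, T i)) := by
        rw [hsplit _ subset_rfl, inter_eq_self_of_subset_right hFH]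
      _ = _ := M.eRk_closure_eq _
  obtain ⟨b, hbT, hinj, hind⟩ := M.exists_indep_range_of_card_le_eRk
    (fun i ↦ (hTfin i).toFinset) (by simpa using hrado)
  refine ⟨b, hinj, hind, fun F hF ↦ ?_⟩
  -- `b` maps `φ(F)` to `r(F)` independent elements of `F`, so they span `F`.
  have hsub : b '' φ ⟨F, hF⟩ ⊆ F ∩ range b := by
    refine subset_inter ?_ (image_subset_range _ _)
    rintro _ ⟨i, hi, rfl⟩
    have := (hTfin i).mem_toFinset.1 (hbT i)
    simp only [hT, mem_inter_iff, mem_iInter] at this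
    exact this.2 ⟨F, hF⟩ hi
  have heq := (RankFinite.isRkFinite (F ∩ range b)).closure_eq_closure_of_subset_of_eRk_ge_eRk
    (inter_subset_left (t := range b)) (by
      rw [← hrk ⟨F, hF⟩, ← hinj.encard_image]
      exact (hind.subset (image_subset_range _ _)).encard_le_eRk_of_subset hsub)
  rw [heq]
  exact M.subset_closure F hF.1.subset_ground

/-! ### Reduction of condition 3 to filters and antichains -/

theorem monotone_of_map_cyclicFlatJoin {α : Type*} {M : Matroid α} {r : ℕ}
    {φ : M.cyclicFlats → Set (Fin r)}
    (hjoin : ∀ F G : M.cyclicFlats, φ (M.cyclicFlatJoin F G) = φ F ∪ φ G) : Monotone φ := by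
  intro F G hFG
  have hG : M.cyclicFlatJoin F G = G := by
    ext1
    change M.closure ((F : Set α) ∪ G) = G
    rw [union_eq_self_of_subset_left (show (F : Set α) ⊆ G from hFG), G.2.1.closure]
  have := hjoin F G
  rw [hG] at this
  exact this ▸ subset_union_left

/-- The intersections in `RankInterEq` do not change when the family is replaced by one that
generates the same filter. -/
theorem rankInterEq_congr {α : Type*} {M : Matroid α} {r : ℕ} {φ : M.cyclicFlats → Set (Fin r)}
    (hφ : Monotone φ) {𝓕 𝓖 : Set M.cyclicFlats} (h : upperClosure 𝓕 = upperClosure 𝓖) :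
    M.RankInterEq φ 𝓕 ↔ M.RankInterEq φ 𝓖 := by
  have hmono : Monotone ((↑) : M.cyclicFlats → Set α) := fun F G h ↦ h
  rw [RankInterEq, RankInterEq, ← hmono.biInter_upperClosure, ← hφ.biInter_upperClosure, h,
    hmono.biInter_upperClosure, hφ.biInter_upperClosure]

end Matroid

theorem theorem4p5 {α : Type*} (M : Matroid α) [M.Finite] (r : ℕ) (hr : M.eRank = (r : ℕ∞)) :
    (M.IsFundamentalTransversal ↔
      ∃ φ : M.cyclicFlats → Set (Fin r), Function.Injective φ ∧
        (∀ F : M.cyclicFlats, (φ F).encard = M.eRk (F : Set α)) ∧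
        (∀ F G : M.cyclicFlats, φ (M.cyclicFlatJoin F G) = φ F ∪ φ G) ∧
        (∀ 𝓕 : Set M.cyclicFlats, M.RankInterEq φ 𝓕)) ∧
    (∀ φ : M.cyclicFlats → Set (Fin r), Function.Injective φ →
      (∀ F : M.cyclicFlats, (φ F).encard = M.eRk (F : Set α)) →
      (∀ F G : M.cyclicFlats, φ (M.cyclicFlatJoin F G) = φ F ∪ φ G) →
      ((∀ 𝓕 : Set M.cyclicFlats, M.RankInterEq φ 𝓕) ↔
        ∀ 𝓕 : Set M.cyclicFlats, IsUpperSet 𝓕 → M.RankInterEq φ 𝓕) ∧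
      ((∀ 𝓕 : Set M.cyclicFlats, M.RankInterEq φ 𝓕) ↔
        ∀ 𝓕 : Set M.cyclicFlats, IsAntichain (· ≤ ·) 𝓕 → M.RankInterEq φ 𝓕)) := by
  refine ⟨⟨fun h ↦ ?_, ?_⟩, fun φ _ _ hjoin ↦ ⟨⟨fun h 𝓕 _ ↦ h 𝓕, fun h 𝓕 ↦ ?_⟩,
    ⟨fun h 𝓕 _ ↦ h 𝓕, fun h 𝓕 ↦ ?_⟩⟩⟩
  · obtain ⟨b, hb⟩ := h.exists_isCyclicFlatFrame hr
    exact hb.exists_map hr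
  · rintro ⟨φ, -, hrk, -, hinter⟩
    obtain ⟨b, hb⟩ := Matroid.exists_isCyclicFlatFrame_of_map hrk hinter
    exact hb.isFundamentalTransversal hr
  · rw [Matroid.rankInterEq_congr (Matroid.monotone_of_map_cyclicFlatJoin hjoin)
      (𝓖 := upperClosure 𝓕) (by simp)]
    exact h _ (UpperSet.upper _)
  · have hfin : Finite M.cyclicFlats :=
      (M.ground_finite.finite_subsets.subset fun F hF ↦ hF.1.subset_ground).to_subtype
    rw [Matroid.rankInterEq_congr (Matroid.monotone_of_map_cyclicFlatJoin hjoin)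
      (𝓖 := {F | Minimal (· ∈ 𝓕) F}) ?_]
    · exact h _ (setOfPred_minimal_antichain _)
    · refine SetLike.ext fun G ↦ ?_
      simp only [mem_upperClosure]
      refine ⟨fun ⟨F, hF, hFG⟩ ↦ ?_, fun ⟨F, hF, hFG⟩ ↦ ⟨F, hF.1, hFG⟩⟩
      obtain ⟨F', hF', hmin⟩ := (toFinite 𝓕).exists_le_minimal hF
      exact ⟨F', hmin, hF'.trans hFG⟩
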